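/- A time series is a nonempty finite sequence of real numbers. Fix $c\ge 0$. Three operations transform a time series $x=(x_1,\dots,x_m)$: a move replaces a point $x_i$ by $x_i+w$ with $w\in\mathbb{R}$, at cost $|w|$; a split replaces a point $x_i$ by two consecutive points $x_i,x_i$, at cost $c$; a merge replaces two consecutive points $x_i=x_{i+1}$ of equal value by one point of that value, at cost $c$. The MSM distance $d(x,y)$ is the minimum, over all finite sequences of operations transforming $x$ into $y$, of the sum of the costs of the operations. Let $x=(x_1,\dots,x_m)$ be a time series, let $q\in\mathbb{R}$, and let $q^{(k)}=(q,\dots,q)$ denote the constant series of length $k$. Define $D_c[m]=|x_m-q|$ and, for $i=m-1,\dots,1$, $$D_c[i]=\begin{cases}D_c[i+1]+2c+\max\bigl(0,\,|x_i-q|-|x_{i+1}-q|\bigr)&\text{if } x_i,x_{i+1}\ge q+2c \text{ or } x_i,x_{i+1}\le q-2c,\\ D_c[i+1]+|x_i-q|&\text{otherwise.}\end{cases}$$ Then, for every $1\le i\le m$, the minimum defining $d\bigl((x_i,\dots,x_m),q^{(m-i+1)}\bigr)$ is attained and equals $D_c[i]$; in particular $d(x,q^{(m)})=D_c[1]$.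 Moreover $d(x,q^{(m)})$ can be computed in linear time: there are one program for a real random access machine (natural-number registers and memory with addition and truncated subtraction; real registers and memory with exact arithmetic; comparisons; indirect addressing; every instruction takes one step) and one constant $C$ such that, for all $c\ge 0$, $q\in\mathbb{R}$, $m\ge 1$ and $x\in\mathbb{R}^m$, the program started on input $(c,q,x)$ halts after at most $C\,m$ steps and outputs $d(x,q^{(m)})$ together with the table $D_c[1],\dots,D_c[m]$. -/

import Mathlib

noncomputable section

namespace MSM

/-! ### Move-split-merge operations and the MSM distance

A time series is a finite list of real numbers. Positions are counted from `1`. -/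

/-- A transformation operation: `move i w`, `split i` or `merge i`. -/
inductive Op where
  | move (i : ℕ) (w : ℝ)
  | split (i : ℕ)
  | merge (i : ℕ)

/-- `Op.Applies o x y`: the operation `o` may be applied to the time series `x`, with result `y`.
In each constructor `u` is the part of the series before the position at which `o` acts. -/
inductive Op.Applies : Op → List ℝ → List ℝ → Prop where
  | move (u v : List ℝ) (a w : ℝ) :
      Op.Applies (Op.move (u.length + 1) w) (u ++ a :: v) (u ++ (a + w) :: v)
  | split (u v : List ℝ) (a : ℝ) :
      Op.Applies (Op.split (u.length + 1)) (u ++ a :: v) (u ++ a :: a :: v)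
  | merge (u v : List ℝ) (a : ℝ) :
      Op.Applies (Op.merge (u.length + 1)) (u ++ a :: a :: v) (u ++ a :: v)

/-- The cost of one operation, where `c` is the cost of a split and of a merge. -/
def Op.cost (c : ℝ) : Op → ℝ
  | Op.move _ w => |w|
  | Op.split _ => c
  | Op.merge _ => c

/-- `Transforms S x y`: applying the operations of `S` one after the other turns `x` into `y`. -/
inductive Transforms : List Op → List ℝ → List ℝ → Prop where
  | nil (x : List ℝ) : Transforms [] x x
  | cons {o : Op} {S : List Op} {x y z : List ℝ} :
      Op.Applies o x y → Transforms S y z → Transforms (o :: S) x z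

/-- The cost of a sequence of operations. -/
def seqCost (c : ℝ) (S : List Op) : ℝ := (S.map (Op.cost c)).sum

/-- `d` is the MSM distance of `x` and `y`: the cost of an optimal (that is, cheapest)
transformation of `x` into `y`. -/
def IsDist (c : ℝ) (x y : List ℝ) (d : ℝ) : Prop :=
  IsLeast {r : ℝ | ∃ S : List Op, Transforms S x y ∧ r = seqCost c S} d

/-! ### The one-dimensional recursion -/

/-- Both points lie at distance at least `2c` from `q`, on the same side of `q`. -/
def BothFar (c q a b : ℝ) : Prop :=
  (q + 2 * c ≤ a ∧ q + 2 * c ≤ b) ∨ (a ≤ q - 2 * c ∧ b ≤ q - 2 * c)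

open Classical in
/-- The recursion, from the last point of the series to the first. For `x = (x_1, …, x_m)`, the
table entry `D_c[i]` is the value at the partial series `(x_i, …, x_m)`. The value at the empty
series is a convention that is never used. -/
def cMSM (c q : ℝ) : List ℝ → ℝ
  | [] => 0
  | [a] => |a - q|
  | a :: b :: l =>
      if BothFar c q a b then
        cMSM c q (b :: l) + 2 * c + max 0 (|a - q| - |b - q|)
      else
        cMSM c q (b :: l) + |a - q|

end MSM

/-! ### Real random access machines with unit-cost steps -/

namespace RealRAM

/-- The instructions. There are registers `N[·]` for natural numbers and `R[·]` for reals, and two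
memories, one for naturals and one for reals, whose cells are addressed by the contents of the
registers `N[·]`. The only operations on reals are exact arithmetic and comparison. -/
inductive Instr where
  /-- `N[i] ← k` -/
  | nconst (i k : ℕ)
  /-- `N[i] ← N[j] + N[k]` -/
  | nadd (i j k : ℕ)
  /-- `N[i] ← max (N[j] - N[k]) 0` -/
  | nsub (i j k : ℕ)
  /-- `N[i] ←` natural memory cell with address `N[j]` -/
  | nload (i j : ℕ)
  /-- natural memory cell with address `N[i]` `← N[j]` -/
  | nstore (i j : ℕ)
  /-- `R[i] ← z` -/
  | rconst (i : ℕ) (z : ℤ)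
  /-- `R[i] ← R[j] + R[k]` -/
  | radd (i j k : ℕ)
  /-- `R[i] ← R[j] - R[k]` -/
  | rsub (i j k : ℕ)
  /-- `R[i] ← R[j] * R[k]` -/
  | rmul (i j k : ℕ)
  /-- `R[i] ← R[j] / R[k]`; the machine hangs if `R[k] = 0` -/
  | rdiv (i j k : ℕ)
  /-- `R[i] ←` real memory cell with address `N[j]` -/
  | rload (i j : ℕ)
  /-- real memory cell with address `N[i]` `← R[j]` -/
  | rstore (i j : ℕ)
  /-- continue at line `l` -/
  | jump (l : ℕ)
  /-- if `N[i] < N[j]` continue at line `l` -/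
  | njlt (i j l : ℕ)
  /-- if `R[i] < R[j]` continue at line `l` -/
  | rjlt (i j l : ℕ)

/-- A program is a finite list of instructions, the lines `0, 1, 2, …`. -/
abbrev Program := List Instr

/-- A configuration: program counter, registers, memories. -/
structure Config where
  pc : ℕ
  nreg : ℕ → ℕ
  rreg : ℕ → ℝ
  nmem : ℕ → ℕ
  rmem : ℕ → ℝ

/-- Set a natural register and go to the next line. -/
def Config.setN (s : Config) (i v : ℕ) : Config :=
  { s with pc := s.pc + 1, nreg := Function.update s.nreg i v }

/-- Set a real register and go to the next line. -/
def Config.setR (s : Config) (i : ℕ) (v : ℝ) : Config :=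
  { s with pc := s.pc + 1, rreg := Function.update s.rreg i v }

open Classical in
/-- The effect of one instruction. -/
def Instr.exec : Instr → Config → Config
  | .nconst i k, s => s.setN i k
  | .nadd i j k, s => s.setN i (s.nreg j + s.nreg k)
  | .nsub i j k, s => s.setN i (s.nreg j - s.nreg k)
  | .nload i j, s => s.setN i (s.nmem (s.nreg j))
  | .nstore i j, s =>
      { s with pc := s.pc + 1, nmem := Function.update s.nmem (s.nreg i) (s.nreg j) }
  | .rconst i z, s => s.setR i (z : ℝ)
  | .radd i j k, s => s.setR i (s.rreg j + s.rreg k)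
  | .rsub i j k, s => s.setR i (s.rreg j - s.rreg k)
  | .rmul i j k, s => s.setR i (s.rreg j * s.rreg k)
  | .rdiv i j k, s => if s.rreg k = 0 then s else s.setR i (s.rreg j / s.rreg k)
  | .rload i j, s => s.setR i (s.rmem (s.nreg j))
  | .rstore i j, s =>
      { s with pc := s.pc + 1, rmem := Function.update s.rmem (s.nreg i) (s.rreg j) }
  | .jump l, s => { s with pc := l }
  | .njlt i j l, s => { s with pc := if s.nreg i < s.nreg j then l else s.pc + 1 }
  | .rjlt i j l, s => { s with pc := if s.rreg i < s.rreg j then l else s.pc + 1 }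

/-- The machine has halted when the program counter has left the program. -/
def Halted (P : Program) (s : Config) : Prop := P.length ≤ s.pc

/-- One step: execute the instruction at the program counter; a halted machine does nothing. -/
def step (P : Program) (s : Config) : Config :=
  match P[s.pc]? with
  | some o => o.exec s
  | none => s

/-- The configuration after `t` steps. -/
def run (P : Program) (t : ℕ) (s : Config) : Config := (step P)^[t] s

/-- The initial configuration on input `(c, q, x)` with `x = (x_1, …, x_m)`: the registers hold
`N[0] = m`, `R[0] = c` and `R[1] = q`, the real memory cells `0, …, m - 1` hold `x_1, …, x_m`, and
all other registers and cells hold `0`. -/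
def init (c q : ℝ) (x : List ℝ) : Config where
  pc := 0
  nreg := fun i => if i = 0 then x.length else 0
  rreg := fun i => if i = 0 then c else if i = 1 then q else 0
  nmem := fun _ => 0
  rmem := fun i => x.getD i 0

end RealRAM

end

/-!
# MSM distance to a constant series

Put `α_i = |x_i - q|`. The recursion is the sum of all `α_i` minus a symmetric `saving` for each
pair of neighbours, namely the part of the way to `q`, beyond distance `2 * c`, that both points
have to travel (`cMSM_cons_cons`).

*No transformation is cheaper.* The recursion makes sense for series of any length and vanishes on
constant series `(q, …, q)`. Moving one point by `w` changes it by at most `|w|`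
(`point_cost_lipschitz_of_le`): on either side of `q` the cost of the point grows with slope `1` and
the two savings it takes part in grow with slopes between `0` and `1`. Doubling a point adds
`min α (2 * c)`, which lies between `0` and `2 * c`. Hence no operation lowers the recursion minus
`c` times the length by more than its cost (`Op.Applies.cMSM_sub_le`), and the lengths cancel at the
end.

*The value is attained.* Points at distance at least `2 * c` from `q` travel towards `q` one after
the other, starting with those farthest away, and merge with the points they meet. Each merge is
undone by a split when everything has arrived at `q`. `reaches_of_stack` carries this out by
recursion along the series, with a stack for the far points that wait to be picked up.

*Linear time.* The form of the recursion with savings holds for the last point too if one imagines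
a point `q` behind it, so one loop without special cases fills the table. A round takes at most `21`
steps (`leads_round`).
-/

namespace MSM

/-! ### The recursion as a sum with savings -/

/-- What the recursion saves on the cost `|a - q|` of a point `a` followed by `b`: the part of the
way to `q` that lies beyond distance `2 * c` and can be shared with `b`. -/
noncomputable def saving (c q a b : ℝ) : ℝ :=
  max 0 (min a b - q - 2 * c) + max 0 (q - max a b - 2 * c)

theorem saving_comm (c q a b : ℝ) : saving c q a b = saving c q b a := by
  simp only [saving, min_comm, max_comm]

theorem saving_right_target {c : ℝ} (hc : 0 ≤ c) (q a : ℝ) : saving c q a q = 0 := by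
  have h₁ := min_le_right a q
  have h₂ := le_max_right a q
  rw [saving, max_eq_left (by linarith), max_eq_left (by linarith), add_zero]

theorem cMSM_cons_cons {c : ℝ} (hc : 0 ≤ c) (q a b : ℝ) (l : List ℝ) :
    cMSM c q (a :: b :: l) = cMSM c q (b :: l) + |a - q| - saving c q a b := by
  rw [cMSM]
  split_ifs with h
  · rcases h with ⟨ha, hb⟩ | ⟨ha, hb⟩
    · rw [abs_of_nonneg (by linarith), abs_of_nonneg (by linarith), saving,
        max_eq_left (b := q - max a b - 2 * c) (by have := le_max_left a b; linarith),
        max_eq_right (b := min a b - q - 2 * c) (by have := le_min ha hb; linarith)]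
      rcases le_total a b with hab | hab
      · rw [max_eq_left (by linarith), min_eq_left hab]; ring
      · rw [max_eq_right (by linarith), min_eq_right hab]; ring
    · rw [abs_of_nonpos (by linarith), abs_of_nonpos (by linarith), saving,
        max_eq_left (b := min a b - q - 2 * c) (by have := min_le_left a b; linarith),
        max_eq_right (b := q - max a b - 2 * c) (by have := max_le ha hb; linarith)]
      rcases le_total a b with hab | hab
      · rw [max_eq_right (by linarith), max_eq_right hab]; ring
      · rw [max_eq_left (by linarith), max_eq_left hab]; ring
  · rw [saving, max_eq_left, max_eq_left]
    · ring
    · by_contra! h'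
      have h₁ := le_max_left a b
      have h₂ := le_max_right a b
      exact h (Or.inr ⟨by linarith, by linarith⟩)
    · by_contra! h'
      have h₁ := min_le_left a b
      have h₂ := min_le_right a b
      exact h (Or.inl ⟨by linarith, by linarith⟩)

/-- The recursion without a special case for the last point: a point equal to `q` behind the series
changes nothing. -/
theorem cMSM_cons {c : ℝ} (hc : 0 ≤ c) (q a : ℝ) (l : List ℝ) :
    cMSM c q (a :: l) = cMSM c q l + |a - q| - saving c q a (l.headD q) := by
  cases l with
  | nil => simp [cMSM, saving_right_target hc]
  | cons b l => exact cMSM_cons_cons hc q a b l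

theorem cMSM_replicate {c : ℝ} (hc : 0 ≤ c) (q : ℝ) (n : ℕ) :
    cMSM c q (List.replicate n q) = 0 := by
  induction n with
  | zero => rfl
  | succ n ih =>
    rw [List.replicate_succ, cMSM_cons hc, ih, saving_comm, saving_right_target hc]
    simp

/-! ### Lower bound: no operation beats the recursion -/

theorem saving_self_le {c : ℝ} (hc : 0 ≤ c) (q a : ℝ) : saving c q a a ≤ |a - q| := by
  simp only [saving, min_self, max_self]
  rcases le_total q a with h | h
  · rw [abs_of_nonneg (by linarith), max_eq_left (b := q - a - 2 * c) (by linarith), add_zero]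
    exact max_le (by linarith) (by linarith)
  · rw [abs_of_nonpos (by linarith), max_eq_left (b := a - q - 2 * c) (by linarith), zero_add]
    exact max_le (by linarith) (by linarith)

theorem abs_sub_le_saving_self (c q a : ℝ) :
    |a - q| ≤ saving c q a a + 2 * c := by
  simp only [saving, min_self, max_self]
  have h₁ := le_max_left 0 (a - q - 2 * c)
  have h₂ := le_max_right 0 (a - q - 2 * c)
  have h₃ := le_max_left 0 (q - a - 2 * c)
  have h₄ := le_max_right 0 (q - a - 2 * c)
  exact abs_le'.2 ⟨by linarith, by linarith⟩

/-- The upper half of a saving grows with a point, but no faster than the excess of the point over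
`q` does. -/
theorem max_min_sub_mem {c : ℝ} (hc : 0 ≤ c) (q p : ℝ) {a a' : ℝ} (h : a ≤ a') :
    0 ≤ max 0 (min p a' - q - 2 * c) - max 0 (min p a - q - 2 * c) ∧
      max 0 (min p a' - q - 2 * c) - max 0 (min p a - q - 2 * c) ≤
        max 0 (a' - q) - max 0 (a - q) := by
  simp only [max_def, min_def]
  constructor <;> split_ifs <;> linarith

/-- Moving one point of a series changes its own cost and the two savings it takes part in by at
most the length of the move. The excess above `q` and the excess below `q` are treated
separately; on each side the cost and both savings are monotone in the point, and the savings are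
the slower ones. -/
theorem point_cost_lipschitz_of_le {c : ℝ} (hc : 0 ≤ c) (q p b : ℝ) {a a' : ℝ} (h : a ≤ a') :
    |(|a' - q| - saving c q p a' - saving c q a' b) -
      (|a - q| - saving c q p a - saving c q a b)| ≤ a' - a := by
  have key : ∀ t : ℝ, |t - q| = max 0 (t - q) + max 0 (q - t) ∧
      t - q = max 0 (t - q) - max 0 (q - t) := by
    intro t
    rcases le_total q t with h | h
    · rw [abs_of_nonneg (by linarith), max_eq_right (by linarith), max_eq_left (by linarith)]
      constructor <;> ring
    · rw [abs_of_nonpos (by linarith), max_eq_left (by linarith), max_eq_right (by linarith)]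
      constructor <;> ring
  have low : ∀ s t : ℝ, max 0 (q - max s t - 2 * c) = max 0 (min (-s) (-t) - -q - 2 * c) := by
    intro s t
    rw [min_neg_neg]
    congr 1
    ring
  have neg : ∀ t : ℝ, max 0 (q - t) = max 0 (-t - -q) := by
    intro t
    congr 1
    ring
  obtain ⟨u₁, u₂⟩ := max_min_sub_mem hc q p h
  obtain ⟨u₃, u₄⟩ := max_min_sub_mem hc q b h
  obtain ⟨v₁, v₂⟩ := max_min_sub_mem hc (-q) (-p) (neg_le_neg h)
  obtain ⟨v₃, v₄⟩ := max_min_sub_mem hc (-q) (-b) (neg_le_neg h)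
  obtain ⟨k₁, k₂⟩ := key a
  obtain ⟨k₃, k₄⟩ := key a'
  rw [k₁, k₃, saving_comm c q a, saving_comm c q a']
  simp only [saving, low]
  rw [neg] at k₂ k₄
  rw [neg a, neg a']
  exact abs_le.2 ⟨by linarith, by linarith⟩

theorem point_cost_le {c : ℝ} (hc : 0 ≤ c) (q p b a w : ℝ) :
    |a - q| - saving c q p a - saving c q a b ≤
      |a + w - q| - saving c q p (a + w) - saving c q (a + w) b + |w| := by
  rcases le_total 0 w with h | h
  · have := (abs_le.1 (point_cost_lipschitz_of_le hc q p b (show a ≤ a + w by linarith))).1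
    rw [abs_of_nonneg h]
    linarith
  · have := (abs_le.1 (point_cost_lipschitz_of_le hc q p b (show a + w ≤ a by linarith))).2
    rw [abs_of_nonpos h]
    linarith

theorem cMSM_move_le {c : ℝ} (hc : 0 ≤ c) (q a w : ℝ) (u v : List ℝ) :
    cMSM c q (u ++ a :: v) ≤ cMSM c q (u ++ (a + w) :: v) + |w| := by
  induction u with
  | nil =>
    have := point_cost_le hc q q (v.headD q) a w
    simp only [saving_comm c q q, saving_right_target hc] at this
    simp only [List.nil_append, cMSM_cons hc q _ v]
    linarith
  | cons p u ih =>
    cases u with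
    | nil =>
      have := point_cost_le hc q p (v.headD q) a w
      simp only [List.cons_append, List.nil_append, cMSM_cons hc q _ v, cMSM_cons_cons hc]
      linarith
    | cons p' u =>
      simp only [List.cons_append, cMSM_cons_cons hc] at ih ⊢
      linarith

theorem cMSM_split {c : ℝ} (hc : 0 ≤ c) (q a : ℝ) (u v : List ℝ) :
    cMSM c q (u ++ a :: a :: v) = cMSM c q (u ++ a :: v) + |a - q| - saving c q a a := by
  induction u with
  | nil => exact cMSM_cons_cons hc q a a v
  | cons p u ih =>
    have head : (u ++ a :: a :: v).headD q = (u ++ a :: v).headD q := by cases u <;> rfl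
    rw [List.cons_append, List.cons_append, cMSM_cons hc, ih, head, cMSM_cons hc q p (u ++ a :: v)]
    ring

/-- A split changes the value of the recursion by an amount between `0` and `2 * c`. Lowering it by
`c` for each point of the series shares that amount between splits and merges. -/
theorem Op.Applies.cMSM_sub_le {c : ℝ} (hc : 0 ≤ c) (q : ℝ) {o : Op} {x y : List ℝ}
    (h : o.Applies x y) :
    cMSM c q x - c * x.length ≤ o.cost c + (cMSM c q y - c * y.length) := by
  cases h with
  | move u v a w =>
    have := cMSM_move_le hc q a w u v
    simp only [Op.cost, List.length_append, List.length_cons]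
    linarith
  | split u v a =>
    have := saving_self_le hc q a
    simp only [Op.cost, List.length_append, List.length_cons, cMSM_split hc]
    push_cast
    linarith
  | merge u v a =>
    have := abs_sub_le_saving_self c q a
    simp only [Op.cost, List.length_append, List.length_cons, cMSM_split hc]
    push_cast
    linarith

theorem Transforms.cMSM_sub_le {c : ℝ} (hc : 0 ≤ c) (q : ℝ) {S : List Op} {x y : List ℝ}
    (h : Transforms S x y) :
    cMSM c q x - c * x.length ≤ seqCost c S + (cMSM c q y - c * y.length) := by
  induction h with
  | nil x => simp [seqCost]
  | cons ho _ ih =>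
    have := ho.cMSM_sub_le hc q
    simp only [seqCost, List.map_cons, List.sum_cons] at ih ⊢
    linarith

theorem cMSM_le_seqCost {c : ℝ} (hc : 0 ≤ c) (q : ℝ) {S : List Op} {x : List ℝ}
    (h : Transforms S x (List.replicate x.length q)) : cMSM c q x ≤ seqCost c S := by
  have := h.cMSM_sub_le hc q
  rw [cMSM_replicate hc, List.length_replicate] at this
  linarith

/-! ### Upper bound: a transformation of the cost given by the recursion -/

/-- Some sequence of operations of total cost at most `r` turns `x` into `y`. -/
def Reaches (c : ℝ) (x y : List ℝ) (r : ℝ) : Prop :=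
  ∃ S : List Op, Transforms S x y ∧ seqCost c S ≤ r

theorem Transforms.append {S T : List Op} {x y z : List ℝ} (h : Transforms S x y)
    (h' : Transforms T y z) : Transforms (S ++ T) x z := by
  induction h with
  | nil => exact h'
  | cons ho _ ih => exact .cons ho (ih h')

namespace Reaches

variable {c r r' : ℝ} {x y z : List ℝ}

theorem refl (c : ℝ) (x : List ℝ) : Reaches c x x 0 := ⟨[], .nil x, by simp [seqCost]⟩

theorem trans (h : Reaches c x y r) (h' : Reaches c y z r') : Reaches c x z (r + r') := by
  obtain ⟨S, hS, hr⟩ := h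
  obtain ⟨T, hT, hr'⟩ := h'
  refine ⟨S ++ T, hS.append hT, ?_⟩
  simp only [seqCost, List.map_append, List.sum_append] at *
  linarith

theorem mono (h : Reaches c x y r) (hr : r ≤ r') : Reaches c x y r' := by
  obtain ⟨S, hS, hS'⟩ := h
  exact ⟨S, hS, hS'.trans hr⟩

theorem of_applies {o : Op} (h : o.Applies x y) : Reaches c x y (o.cost c) :=
  ⟨[o], .cons h (.nil y), by simp [seqCost]⟩

theorem move (c : ℝ) (u v : List ℝ) (a b : ℝ) : Reaches c (u ++ a :: v) (u ++ b :: v) |b - a| := by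
  simpa [Op.cost] using of_applies (c := c) (Op.Applies.move u v a (b - a))

theorem merge (c : ℝ) (u v : List ℝ) (a : ℝ) : Reaches c (u ++ a :: a :: v) (u ++ a :: v) c :=
  of_applies (Op.Applies.merge u v a)

theorem split_replicate (c q : ℝ) (n : ℕ) :
    Reaches c (List.replicate (n + 1) q) (List.replicate (n + 2) q) c :=
  of_applies (Op.Applies.split [] (List.replicate n q) q)

theorem cons (a : ℝ) (h : Reaches c x y r) : Reaches c (a :: x) (a :: y) r := by
  obtain ⟨S, hS, hr⟩ := h
  suffices ∃ T : List Op, Transforms T (a :: x) (a :: y) ∧ seqCost c T = seqCost c S by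
    obtain ⟨T, hT, hT'⟩ := this
    exact ⟨T, hT, hT'.trans_le hr⟩
  clear hr
  induction hS with
  | nil x => exact ⟨[], .nil _, rfl⟩
  | cons ho _ ih =>
    obtain ⟨T, hT, hT'⟩ := ih
    cases ho with
    | move u v b w =>
      exact ⟨_, .cons (Op.Applies.move (a :: u) v b w) hT, by simp_all [seqCost, Op.cost]⟩
    | split u v b =>
      exact ⟨_, .cons (Op.Applies.split (a :: u) v b) hT, by simp_all [seqCost, Op.cost]⟩
    | merge u v b =>
      exact ⟨_, .cons (Op.Applies.merge (a :: u) v b) hT, by simp_all [seqCost, Op.cost]⟩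

/-- Two neighbouring points can be treated as one at the price of moving them together, a merge,
and a split at the end. -/
theorem of_merge {q : ℝ} {n : ℕ} (u v : List ℝ) (a : ℝ)
    (h : Reaches c (u ++ a :: v) (List.replicate (n + 1) q) r) :
    Reaches c (u ++ a :: a :: v) (List.replicate (n + 2) q) (r + 2 * c) :=
  (((merge c u v a).trans h).trans (split_replicate c q n)).mono (by linarith)

end Reaches

/-- `Beyond c q b a`: the point `a` is at distance at least `2 * c` from `q`, and it lies on the way
from `b` to `q`, so that `b` can pick it up. -/
def Beyond (c q b a : ℝ) : Prop := (q + 2 * c ≤ a ∧ a ≤ b) ∨ (b ≤ a ∧ a ≤ q - 2 * c)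

theorem Beyond.abs_sub {c q a b : ℝ} (hc : 0 ≤ c) (h : Beyond c q b a) :
    |a - b| = |b - q| - |a - q| := by
  rcases h with ⟨h₁, h₂⟩ | ⟨h₁, h₂⟩
  · rw [abs_of_nonpos (by linarith), abs_of_nonneg (by linarith), abs_of_nonneg (by linarith)]
    ring
  · rw [abs_of_nonneg (by linarith), abs_of_nonpos (by linarith), abs_of_nonpos (by linarith)]
    ring

theorem Beyond.saving_eq {c q a b : ℝ} (hc : 0 ≤ c) (h : Beyond c q b a) :
    saving c q a b = |a - q| - 2 * c := by
  rcases h with ⟨h₁, h₂⟩ | ⟨h₁, h₂⟩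
  · rw [saving, min_eq_left h₂, max_eq_right h₂, max_eq_right (by linarith),
      max_eq_left (by linarith), abs_of_nonneg (by linarith)]
    ring
  · rw [saving, min_eq_right h₁, max_eq_left h₁, max_eq_left (by linarith),
      max_eq_right (by linarith), abs_of_nonpos (by linarith)]
    ring

/-- Pulling `b` in to a point `a` on its way loses no saving with the next point `b'`, unless `b'`
lies between them or beyond `b`. -/
theorem Beyond.saving_le {c q a b b' : ℝ} (hc : 0 ≤ c) (h : Beyond c q b a)
    (h₁ : ¬ Beyond c q b' b) (h₂ : ¬ (Beyond c q b b' ∧ Beyond c q b' a)) :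
    saving c q b b' ≤ saving c q a b' := by
  rcases h with ⟨ha, hab⟩ | ⟨hab, ha⟩
  · have hb' : b' < b := by
      by_contra! h'
      exact h₁ (Or.inl ⟨ha.trans hab, h'⟩)
    have hb'a : b' ≤ a := by
      by_contra! h'
      exact h₂ ⟨Or.inl ⟨by linarith, hb'.le⟩, Or.inl ⟨ha, h'.le⟩⟩
    rw [saving, saving, min_eq_right hb'.le, max_eq_left hb'.le, min_eq_right hb'a,
      max_eq_left hb'a, max_eq_left (b := q - b - 2 * c) (by linarith)]
    gcongr
    exact le_max_left _ _
  · have hb' : b < b' := by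
      by_contra! h'
      exact h₁ (Or.inr ⟨h', hab.trans ha⟩)
    have hb'a : a ≤ b' := by
      by_contra! h'
      exact h₂ ⟨Or.inr ⟨hb'.le, by linarith⟩, Or.inr ⟨h'.le, ha⟩⟩
    rw [saving, saving, min_eq_left hb'.le, max_eq_right hb'.le, min_eq_left hb'a,
      max_eq_right hb'a, max_eq_left (b := b - q - 2 * c) (by linarith)]
    gcongr
    exact le_max_left _ _

/-- In front of the point `b` there is a stack `st` of far points, approaching `q` as one goes
away from `b`. Since `b` can pick them all up on its way to `q`, each costs a merge and a split
only. The next point of the series is pushed on the stack if it lies beyond `b`; otherwise `b`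
moves towards `q` to the top of the stack or to the next point, whichever comes first, and merges
with it; if there is neither, it moves to `q`. -/
theorem reaches_of_stack {c : ℝ} (hc : 0 ≤ c) (q : ℝ) (l : List ℝ) :
    ∀ (b : ℝ) (st : List ℝ), (b :: st).IsChain (Beyond c q) →
      Reaches c (st.reverse ++ b :: l) (List.replicate (st.length + l.length + 1) q)
        (cMSM c q (b :: l) + 2 * c * st.length) := by
  -- The step in which `b` moves to the top `s` of the stack.
  have pop : ∀ (b s : ℝ) (st l : List ℝ),
      cMSM c q (s :: l) + |s - b| ≤ cMSM c q (b :: l) →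
      Reaches c (st.reverse ++ s :: l) (List.replicate (st.length + l.length + 1) q)
        (cMSM c q (s :: l) + 2 * c * st.length) →
      Reaches c ((s :: st).reverse ++ b :: l)
        (List.replicate ((s :: st).length + l.length + 1) q)
        (cMSM c q (b :: l) + 2 * c * (s :: st).length) := by
    intro b s st l hs h
    have h₁ : Reaches c ((s :: st).reverse ++ b :: l) (st.reverse ++ s :: s :: l) |s - b| := by
      simpa using Reaches.move c (s :: st).reverse l b s
    have h₂ := h₁.trans (h.of_merge st.reverse l s)
    rw [show (s :: st).length + l.length + 1 = st.length + l.length + 2 by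
      rw [List.length_cons]; omega]
    refine h₂.mono ?_
    rw [List.length_cons]
    push_cast
    linarith
  induction l with
  | nil =>
    intro b st
    induction st generalizing b with
    | nil =>
      intro _
      simpa [cMSM, abs_sub_comm] using Reaches.move c [] [] b q
    | cons s st ih =>
      intro h
      rw [List.isChain_cons_cons] at h
      refine pop b s st [] ?_ (ih s h.2)
      simp [cMSM, h.1.abs_sub hc]
  | cons b' l ihl =>
    intro b st
    induction st generalizing b with
    | nil =>
      intro _
      by_cases h₁ : Beyond c q b' b
      · have h₃ := ihl b' [b] (by simpa using h₁)
        simp only [List.reverse_singleton, List.singleton_append, List.length_singleton,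
          Nat.add_comm 1] at h₃
        simp only [List.reverse_nil, List.nil_append, List.length_nil, List.length_cons, zero_add]
        refine h₃.mono ?_
        rw [cMSM_cons_cons hc, h₁.saving_eq hc, Nat.cast_one, Nat.cast_zero]
        linarith
      · by_cases h₂ : Beyond c q b b'
        · have h₃ := (Reaches.move c [] (b' :: l) b b').trans
            ((ihl b' [] (List.isChain_singleton _)).of_merge [] l b')
          simp only [List.nil_append, List.length_nil, List.length_cons, zero_add] at h₃ ⊢
          refine h₃.mono ?_
          rw [cMSM_cons_cons hc, saving_comm, h₂.saving_eq hc, h₂.abs_sub hc]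
          simp
          linarith
        · have hbf : ¬ BothFar c q b b' := by
            rintro (⟨h₃, h₄⟩ | ⟨h₃, h₄⟩) <;> rcases le_total b b' with h₅ | h₅
            · exact h₁ (Or.inl ⟨h₃, h₅⟩)
            · exact h₂ (Or.inl ⟨h₄, h₅⟩)
            · exact h₂ (Or.inr ⟨h₅, h₄⟩)
            · exact h₁ (Or.inr ⟨h₅, h₃⟩)
          have h₃ := (Reaches.move c [] (b' :: l) b q).trans
            ((ihl b' [] (List.isChain_singleton _)).cons q)
          simp only [List.nil_append, List.reverse_nil, List.length_nil, List.length_cons,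
            zero_add, ← List.replicate_succ] at h₃ ⊢
          refine h₃.mono ?_
          rw [cMSM, if_neg hbf, abs_sub_comm q b]
          simp
          linarith
    | cons s st ihst =>
      intro h
      have hbs := (List.isChain_cons_cons.1 h).1
      have hst := (List.isChain_cons_cons.1 h).2
      by_cases h₁ : Beyond c q b' b
      · have h₃ := ihl b' (b :: s :: st) (List.isChain_cons_cons.2 ⟨h₁, h⟩)
        rw [List.reverse_cons, List.append_assoc, List.singleton_append] at h₃
        rw [show (s :: st).length + (b' :: l).length + 1 = (b :: s :: st).length + l.length + 1 by
          simp only [List.length_cons]; omega]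
        refine h₃.mono ?_
        rw [cMSM_cons_cons hc, h₁.saving_eq hc, List.length_cons (a := b)]
        push_cast
        linarith
      · by_cases h₂ : Beyond c q b b' ∧ Beyond c q b' s
        · have h₃ := (Reaches.move c (s :: st).reverse (b' :: l) b b').trans
            ((ihl b' (s :: st) (List.isChain_cons_cons.2 ⟨h₂.2, hst⟩)).of_merge _ l b')
          rw [show (s :: st).length + (b' :: l).length + 1 = (s :: st).length + l.length + 2 by
            simp only [List.length_cons]; omega]
          refine h₃.mono ?_
          rw [cMSM_cons_cons hc, saving_comm, h₂.1.saving_eq hc, h₂.1.abs_sub hc]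
          linarith
        · refine pop b s st (b' :: l) ?_ (ihst s hst)
          have := hbs.saving_le hc h₁ h₂
          rw [cMSM_cons_cons hc, cMSM_cons_cons hc, hbs.abs_sub hc]
          linarith

theorem isDist_cMSM {c : ℝ} (hc : 0 ≤ c) (q : ℝ) {x : List ℝ} (hx : x ≠ []) :
    IsDist c x (List.replicate x.length q) (cMSM c q x) := by
  obtain ⟨b, l, rfl⟩ := List.exists_cons_of_ne_nil hx
  obtain ⟨S, hS, hr⟩ := reaches_of_stack hc q l b [] (List.isChain_singleton b)
  simp only [List.reverse_nil, List.nil_append, List.length_nil, zero_add, Nat.cast_zero,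
    mul_zero, add_zero] at hS hr
  refine ⟨⟨S, hS, (cMSM_le_seqCost hc q hS).antisymm hr⟩, ?_⟩
  rintro _ ⟨T, hT, rfl⟩
  exact cMSM_le_seqCost hc q hT

end MSM

/-! ### The program -/

namespace RealRAM

/-- The program that fills the table from the last point to the first. `N[1]` counts the points that
are left, `R[2] = 2 * c`, `R[3]` holds `x_{i+1} - q` (at first `0`, as if one more point equal
to `q` followed), and `R[0]` holds the last table entry. Lines 10 to 13 add `|x_i - q|` to `R[0]`,
lines 14 to 19 and 20 to 25 subtract the two halves of the saving, and lines 26 to 28 store the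
entry and prepare the next round. -/
def msmProgram : Program :=
  [.nconst 2 1,       .nadd 1 0 4,        .radd 2 0 0,        .rconst 0 0,
   .njlt 4 1 6,       .jump 29,
   .nsub 1 1 2,       .nadd 3 0 1,        .rload 4 1,         .rsub 4 4 1,
   .rjlt 4 6 13,      .radd 0 0 4,        .jump 14,           .rsub 0 0 4,
   .rjlt 3 4 17,      .rsub 7 4 2,        .jump 18,           .rsub 7 3 2,
   .rjlt 7 6 20,      .rsub 0 0 7,
   .rjlt 3 4 23,      .radd 7 3 2,        .jump 24,           .radd 7 4 2,
   .rjlt 6 7 26,      .radd 0 0 7,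
   .radd 3 4 6,       .rstore 3 0,        .jump 4]

/-- Running `P` from `s` leads to a configuration with property `Q` in at most `n` steps. -/
def Leads (P : Program) (n : ℕ) (s : Config) (Q : Config → Prop) : Prop :=
  ∃ t ≤ n, Q (run P t s)

namespace Leads

variable {P : Program} {n n' : ℕ} {s : Config} {Q Q' : Config → Prop}

theorem trans (h : Leads P n s Q) (h' : ∀ s', Q s' → Leads P n' s' Q') :
    Leads P (n + n') s Q' := by
  obtain ⟨t, ht, hQ⟩ := h
  obtain ⟨t', ht', hQ'⟩ := h' _ hQ
  refine ⟨t' + t, by omega, ?_⟩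
  rwa [run, Function.iterate_add_apply]

theorem mono (h : Leads P n s Q) (hn : n ≤ n') : Leads P n' s Q := by
  obtain ⟨t, ht, hQ⟩ := h
  exact ⟨t, ht.trans hn, hQ⟩

theorem zero (h : Q s) : Leads P 0 s Q := ⟨0, le_rfl, h⟩

theorem succ (h : Leads P n (step P s) Q) : Leads P (n + 1) s Q := by
  obtain ⟨t, ht, hQ⟩ := h
  exact ⟨t + 1, by omega, by rwa [run, Function.iterate_succ_apply]⟩

end Leads

/-- The part of the computation state the rest of the program relies on, at line `l` of the round
for the point with index `k`: `d` is the content of the accumulator `R[0]`, and `b` and `a` are the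
differences of the next and of the current point to `q`. -/
structure RoundState (c q : ℝ) (m k l : ℕ) (M : ℕ → ℝ) (d b a : ℝ) (s : Config) : Prop where
  pc : s.pc = l
  n0 : s.nreg 0 = m
  n1 : s.nreg 1 = k
  n2 : s.nreg 2 = 1
  n3 : s.nreg 3 = m + k
  n4 : s.nreg 4 = 0
  r0 : s.rreg 0 = d
  r1 : s.rreg 1 = q
  r2 : s.rreg 2 = 2 * c
  r3 : s.rreg 3 = b
  r4 : s.rreg 4 = a
  r6 : s.rreg 6 = 0
  mem : s.rmem = M

section Round

variable {c q d b a : ℝ} {m k : ℕ} {M : ℕ → ℝ} {s : Config}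

theorem leads_abs (h : RoundState c q m k 10 M d b a s) :
    Leads msmProgram 3 s (RoundState c q m k 14 M (d + |a|) b a) := by
  obtain ⟨pc, n0, n1, n2, n3, n4, r0, r1, r2, r3, r4, r6, mem⟩ := h
  by_cases ha : a < 0
  · refine Leads.mono (n := 2) (.succ (.succ (.zero ?_))) (by norm_num)
    constructor <;> simp [step, msmProgram, Instr.exec, Config.setR, *, abs_of_neg]
    ring
  · refine .succ (.succ (.succ (.zero ?_)))
    constructor <;> simp [step, msmProgram, Instr.exec, Config.setR, *, abs_of_nonneg (not_lt.1 ha)]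

/-- Lines 14 to 19 subtract the part of the saving above `q`. -/
theorem leads_upper (h : RoundState c q m k 14 M d b a s) :
    Leads msmProgram 5 s
      (RoundState c q m k 20 M (d - max 0 (min a b - 2 * c)) b a) := by
  have h₁ : Leads msmProgram 3 s fun s' => RoundState c q m k 18 M d b a s' ∧
      s'.rreg 7 = min a b - 2 * c := by
    obtain ⟨pc, n0, n1, n2, n3, n4, r0, r1, r2, r3, r4, r6, mem⟩ := h
    by_cases hab : b < a
    · refine Leads.mono (n := 2) (.succ (.succ (.zero ⟨?_, ?_⟩))) (by norm_num)
      · constructor <;> simp [step, msmProgram, Instr.exec, Config.setR, *]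
      · simp [step, msmProgram, Instr.exec, Config.setR, *, min_eq_right hab.le]
    · refine .succ (.succ (.succ (.zero ⟨?_, ?_⟩)))
      · constructor <;> simp [step, msmProgram, Instr.exec, Config.setR, *]
      · simp [step, msmProgram, Instr.exec, Config.setR, *, min_eq_left (not_lt.1 hab)]
  refine h₁.trans (n' := 2) ?_
  rintro s' ⟨⟨pc, n0, n1, n2, n3, n4, r0, r1, r2, r3, r4, r6, mem⟩, r7⟩
  by_cases hv : min a b - 2 * c < 0
  · refine Leads.mono (n := 1) (.succ (.zero ?_)) (by norm_num)
    rw [max_eq_left hv.le, sub_zero]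
    rw [← r7] at hv
    clear r7
    constructor <;> simp [step, msmProgram, Instr.exec, *]
  · refine .succ (.succ (.zero ?_))
    rw [max_eq_right (not_lt.1 hv)]
    rw [← r7] at hv ⊢
    clear r7
    constructor <;> simp [step, msmProgram, Instr.exec, Config.setR, *]

/-- Lines 20 to 25 subtract the part of the saving below `q`. Before truncation at `0` it is the
negative of the content of `R[7]`. -/
theorem leads_lower (h : RoundState c q m k 20 M d b a s) :
    Leads msmProgram 5 s
      (RoundState c q m k 26 M (d - max 0 (-max a b - 2 * c)) b a) := by
  have h₁ : Leads msmProgram 3 s fun s' => RoundState c q m k 24 M d b a s' ∧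
      s'.rreg 7 = max a b + 2 * c := by
    obtain ⟨pc, n0, n1, n2, n3, n4, r0, r1, r2, r3, r4, r6, mem⟩ := h
    by_cases hab : b < a
    · refine Leads.mono (n := 2) (.succ (.succ (.zero ⟨?_, ?_⟩))) (by norm_num)
      · constructor <;> simp [step, msmProgram, Instr.exec, Config.setR, *]
      · simp [step, msmProgram, Instr.exec, Config.setR, *, max_eq_left hab.le]
    · refine .succ (.succ (.succ (.zero ⟨?_, ?_⟩)))
      · constructor <;> simp [step, msmProgram, Instr.exec, Config.setR, *]
      · simp [step, msmProgram, Instr.exec, Config.setR, *, max_eq_right (not_lt.1 hab)]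
  refine h₁.trans (n' := 2) ?_
  rintro s' ⟨⟨pc, n0, n1, n2, n3, n4, r0, r1, r2, r3, r4, r6, mem⟩, r7⟩
  rw [show -max a b - 2 * c = -(max a b + 2 * c) by ring, ← r7]
  clear r7
  by_cases hv : 0 < s'.rreg 7
  · refine Leads.mono (n := 1) (.succ (.zero ?_)) (by norm_num)
    rw [max_eq_left (by linarith), sub_zero]
    constructor <;> simp [step, msmProgram, Instr.exec, *]
  · refine .succ (.succ (.zero ?_))
    rw [max_eq_right (by linarith)]
    constructor <;> simp [step, msmProgram, Instr.exec, Config.setR, *]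

end Round

/-! ### The loop -/

/-- The loop invariant, at line 4: `k` points are left, and the table is complete from index `k`
on. -/
structure LoopState (c q : ℝ) (x : List ℝ) (k : ℕ) (s : Config) : Prop where
  pc : s.pc = 4
  n0 : s.nreg 0 = x.length
  n1 : s.nreg 1 = k
  n2 : s.nreg 2 = 1
  n4 : s.nreg 4 = 0
  r0 : s.rreg 0 = MSM.cMSM c q (x.drop k)
  r1 : s.rreg 1 = q
  r2 : s.rreg 2 = 2 * c
  r3 : s.rreg 3 = (x.drop k).headD q - q
  r6 : s.rreg 6 = 0
  input : ∀ i < x.length, s.rmem i = x.getD i 0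
  table : ∀ i < x.length, k ≤ i → s.rmem (x.length + i) = MSM.cMSM c q (x.drop i)

variable {c q : ℝ} {x : List ℝ} {k : ℕ}

theorem leads_loopState_init : Leads msmProgram 4 (init c q x) (LoopState c q x x.length) := by
  refine .succ (.succ (.succ (.succ (.zero ?_))))
  constructor <;>
    simp +contextual [step, msmProgram, Instr.exec, Config.setR, Config.setN, init, MSM.cMSM]
  ring

theorem saving_shift (c q a b : ℝ) : MSM.saving c q a b =
    max 0 (min (a - q) (b - q) - 2 * c) + max 0 (-max (a - q) (b - q) - 2 * c) := by
  rw [MSM.saving, min_sub_sub_right, max_sub_sub_right, neg_sub]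

theorem leads_round (hc : 0 ≤ c) (hk : k < x.length) {s : Config}
    (h : LoopState c q x (k + 1) s) : Leads msmProgram 21 s (LoopState c q x k) := by
  obtain ⟨pc, n0, n1, n2, n4, r0, r1, r2, r3, r6, input, table⟩ := h
  have hx := input k hk
  rw [List.getD_eq_getElem _ _ hk] at hx
  have h₁ : Leads msmProgram 5 s (RoundState c q x.length k 10 s.rmem
      (MSM.cMSM c q (x.drop (k + 1))) ((x.drop (k + 1)).headD q - q) (x[k] - q)) := by
    refine .succ (.succ (.succ (.succ (.succ (.zero ?_)))))
    constructor <;>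
      simp [step, msmProgram, Instr.exec, Config.setR, Config.setN, *]
  refine (((h₁.trans fun _ => leads_abs).trans fun _ => leads_upper).trans
    fun _ => leads_lower).trans (n' := 3) ?_
  rintro s' ⟨pc, n0, n1, n2, n3, n4, r0, r1, r2, r3, r4, r6, mem⟩
  have hd : s'.rreg 0 = MSM.cMSM c q (x.drop k) := by
    rw [r0, List.drop_eq_getElem_cons hk, MSM.cMSM_cons hc, saving_shift]
    ring
  clear r0
  refine .succ (.succ (.succ (.zero ?_)))
  constructor
  case input =>
    intro i hi
    have : i ≠ x.length + k := by omega
    simp [step, msmProgram, Instr.exec, Config.setR, *]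
  case table =>
    intro i hi hki
    rcases hki.eq_or_lt with rfl | hki
    · simp [step, msmProgram, Instr.exec, Config.setR, *]
    · have : i ≠ k := by omega
      simp [step, msmProgram, Instr.exec, Config.setR, *]
  case r3 =>
    rw [List.drop_eq_getElem_cons hk]
    simp [step, msmProgram, Instr.exec, Config.setR, *]
  all_goals simp [step, msmProgram, Instr.exec, Config.setR, *]

/-- The final configuration: the machine has halted with the complete table and the value of the
recursion at `x`. -/
structure Finished (c q : ℝ) (x : List ℝ) (s : Config) : Prop where
  halted : Halted msmProgram s
  value : s.rreg 0 = MSM.cMSM c q x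
  table : ∀ i < x.length, s.rmem (x.length + i) = MSM.cMSM c q (x.drop i)

theorem leads_finished_of_loopState (hc : 0 ≤ c) (hk : k ≤ x.length) {s : Config}
    (h : LoopState c q x k s) : Leads msmProgram (21 * k + 2) s (Finished c q x) := by
  induction k generalizing s with
  | zero =>
    obtain ⟨pc, n0, n1, n2, n4, r0, r1, r2, r3, r6, input, table⟩ := h
    refine .succ (.succ (.zero ?_))
    constructor <;> simp [step, msmProgram, Instr.exec, Halted, *]
    simpa using table
  | succ k ih =>
    exact ((leads_round hc hk h).trans fun _ => ih (by omega)).mono (by omega)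

end RealRAM

/-- The table entries of the recursion are the MSM distances of the partial time series
`(x_i, …, x_m)` to the constant series `(q, …, q)` of the same length, and one fixed real RAM
program computes the table (in the `m` memory cells behind the input) and the MSM distance of `x`
to the constant series of length `m` (in register `R[0]`) in at most `C * m` steps. -/
theorem mainTheorem1 :
    (∀ (c q : ℝ) (x : List ℝ), 0 ≤ c → x ≠ [] → ∀ i : ℕ, i < x.length →
      MSM.IsDist c (x.drop i) (List.replicate (x.length - i) q) (MSM.cMSM c q (x.drop i))) ∧
    ∃ (P : RealRAM.Program) (C : ℕ), ∀ (c q : ℝ) (x : List ℝ), 0 ≤ c → x ≠ [] →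
      ∃ t : ℕ, t ≤ C * x.length ∧
        RealRAM.Halted P (RealRAM.run P t (RealRAM.init c q x)) ∧
        MSM.IsDist c x (List.replicate x.length q)
          ((RealRAM.run P t (RealRAM.init c q x)).rreg 0) ∧
        ∀ i : ℕ, i < x.length →
          (RealRAM.run P t (RealRAM.init c q x)).rmem (x.length + i)
            = MSM.cMSM c q (x.drop i) := by
  refine ⟨fun c q x hc _ i hi => ?_, RealRAM.msmProgram, 27, fun c q x hc hx => ?_⟩
  · rw [← List.length_drop]
    exact MSM.isDist_cMSM hc q (by simpa using hi)
  · -- There are `4` steps before the loop, `21` in each round and `2` to leave the loop.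
    obtain ⟨t, ht, h⟩ := RealRAM.leads_loopState_init.trans fun _ =>
      RealRAM.leads_finished_of_loopState (c := c) (q := q) hc (le_refl x.length)
    have := List.length_pos_iff.2 hx
    exact ⟨t, by omega, h.halted, h.value ▸ MSM.isDist_cMSM hc q hx, h.table⟩
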